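/- Consider unimodal propositional formulas built from variables $p_0,p_1,\dots$ by Boolean connectives and $\Diamond$, with $\Box=\neg\Diamond\neg$. A (normal) logic is a set of formulas that contains all classical tautologies, $\neg\Diamond\bot$ and $\Diamond(p_0\vee p_1)\to\Diamond p_0\vee\Diamond p_1$, and is closed under modus ponens, substitution and monotonicity ($\varphi\to\psi\in L$ implies $\Diamond\varphi\to\Diamond\psi\in L$). A $k$-formula is a formula whose variables are among $p_i$, $i<k$. A logic is locally tabular if for each finite $k$ there are only finitely many $k$-formulas up to $L$-equivalence ($\varphi\leftrightarrow\psi\in L$). The modal depth $\mathrm{md}(\varphi)$ is the maximal number of nested modalities in $\varphi$, and $\mathrm{md}(L)=\sup_\varphi\min\{\mathrm{md}(\psi)\mid \varphi\leftrightarrow\psi\in L\}\in\mathbb N\cup\{\infty\}$. Let $\Diamond^{\le m}\varphi=\bigvee_{i\le m}\Diamond^i\varphi$. A logic is $m$-transitive if it contains $\Diamond^{m+1}p_0\to\Diamond^{\le m}p_0$; it is pretransitive if it is $m$-transitive for some finite $m$. Let $B_0=\bot$ and $B_h=p_h\to\Box(\Diamond p_h\vee B_{h-1})$. For a pretransitive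 logic $L$, where $m$ is the least number such that $L$ is $m$-transitive, $B_h^*$ is the result of replacing each $\Diamond$ in $B_h$ with $\Diamond^{\le m}$; the height of $L$ is the least $h$ with $B_h^*\in L$ (infinite if there is none, or if $L$ is not pretransitive), and $L[h]$ is the least logic containing $L$ and $B_h^*$. Let $\mathrm{wK4}$ be the least logic containing $\Diamond\Diamond p_0\to\Diamond p_0\vee p_0$. Then: 1. $\mathrm{wK4}$ is the least 1-transitive logic. 2. For every integer $h\ge 1$, $\mathrm{md}(\mathrm{wK4}[h])\le 4h-2$. 3. For every logic $L\supseteq\mathrm{wK4}$ the following are equivalent: $L$ is locally tabular; $\mathrm{md}(L)$ is finite; the height of $L$ is finite. 4. Consequently, every 1-transitive locally tabular logic has finite modal depth. -/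

import Mathlib

/-- Unimodal propositional formulas over the variables `p₀, p₁, …`; the other connectives are
defined classically from `⊥`, `→` and `◇`. -/
inductive MFormula : Type
  | var : ℕ → MFormula
  | bot : MFormula
  | imp : MFormula → MFormula → MFormula
  | dia : MFormula → MFormula

namespace MFormula

def neg (φ : MFormula) : MFormula := imp φ bot

def or (φ ψ : MFormula) : MFormula := imp (neg φ) ψ

def and (φ ψ : MFormula) : MFormula := neg (imp φ (neg ψ))

def iff (φ ψ : MFormula) : MFormula := and (imp φ ψ) (imp ψ φ)

/-- `□φ = ¬◇¬φ`. -/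
def box (φ : MFormula) : MFormula := neg (dia (neg φ))

/-- Uniform substitution of formulas for variables. -/
def subst (s : ℕ → MFormula) : MFormula → MFormula
  | var n => s n
  | bot => bot
  | imp φ ψ => imp (subst s φ) (subst s ψ)
  | dia φ => dia (subst s φ)

/-- Boolean evaluation, where variables and formulas `◇φ` are treated as atoms. -/
def boolEval (v : ℕ → Prop) (d : MFormula → Prop) : MFormula → Prop
  | var n => v n
  | bot => False
  | imp φ ψ => boolEval v d φ → boolEval v d ψ
  | dia φ => d φ

def IsTautology (φ : MFormula) : Prop := ∀ v d, boolEval v d φ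

/-- Modal depth: the maximal number of nested modalities. -/
def depth : MFormula → ℕ
  | var _ => 0
  | bot => 0
  | imp φ ψ => max (depth φ) (depth ψ)
  | dia φ => depth φ + 1

/-- `k`-formulas: all variables are among `pᵢ`, `i < k`. -/
def IsKFormula (k : ℕ) : MFormula → Prop
  | var n => n < k
  | bot => True
  | imp φ ψ => IsKFormula k φ ∧ IsKFormula k ψ
  | dia φ => IsKFormula k φ

/-- `◇ⁱφ`. -/
def diaPow : ℕ → MFormula → MFormula
  | 0, φ => φ
  | i + 1, φ => dia (diaPow i φ)

/-- `◇^{≤m}φ`, the disjunction of `◇ⁱφ` over `i ≤ m`. -/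
def diaLE : ℕ → MFormula → MFormula
  | 0, φ => φ
  | m + 1, φ => or (diaLE m φ) (diaPow (m + 1) φ)

/-- The formula of `m`-transitivity: `◇^{m+1}p → ◇^{≤m}p`. -/
def transFormula (m : ℕ) : MFormula := imp (diaPow (m + 1) (var 0)) (diaLE m (var 0))

/-- The formulas of finite height: `B₀ = ⊥` and `B_h = p_h → □(◇p_h ∨ B_{h-1})`. -/
def heightFormula : ℕ → MFormula
  | 0 => bot
  | h + 1 => imp (var (h + 1)) (box (or (dia (var (h + 1))) (heightFormula h)))

/-- Replace every occurrence of `◇` by `◇^{≤m}`. -/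
def replaceDia (m : ℕ) : MFormula → MFormula
  | var n => var n
  | bot => bot
  | imp φ ψ => imp (replaceDia m φ) (replaceDia m ψ)
  | dia φ => diaLE m (replaceDia m φ)

end MFormula

/-- Normal unimodal logics. -/
structure IsNormalLogic (L : Set MFormula) : Prop where
  taut : ∀ φ, φ.IsTautology → φ ∈ L
  dia_bot : MFormula.neg (MFormula.dia MFormula.bot) ∈ L
  dia_or : MFormula.imp (MFormula.dia (MFormula.or (MFormula.var 0) (MFormula.var 1)))
    (MFormula.or (MFormula.dia (MFormula.var 0)) (MFormula.dia (MFormula.var 1))) ∈ L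
  mp : ∀ φ ψ, MFormula.imp φ ψ ∈ L → φ ∈ L → ψ ∈ L
  subst : ∀ (s : ℕ → MFormula) (φ : MFormula), φ ∈ L → φ.subst s ∈ L
  mono : ∀ φ ψ, MFormula.imp φ ψ ∈ L → MFormula.imp (MFormula.dia φ) (MFormula.dia ψ) ∈ L

namespace NormalLogic

/-- The least normal logic that contains `Φ`. -/
def generatedBy (Φ : Set MFormula) : Set MFormula := {φ | ∀ L, IsNormalLogic L → Φ ⊆ L → φ ∈ L}

/-- `wK4`, the normal logic given by the formula `◇◇p → ◇p ∨ p`. -/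
def wK4 : Set MFormula :=
  generatedBy {MFormula.imp (MFormula.dia (MFormula.dia (MFormula.var 0)))
    (MFormula.or (MFormula.dia (MFormula.var 0)) (MFormula.var 0))}

def IsTransitive (m : ℕ) (L : Set MFormula) : Prop := MFormula.transFormula m ∈ L

/-- The least `m` such that `L` is `m`-transitive, and `⊤` if there is none. -/
noncomputable def transIndex (L : Set MFormula) : ℕ∞ :=
  ⨅ (m : ℕ) (_ : IsTransitive m L), (m : ℕ∞)

/-- `φ` is the formula `B_h^*` of `L`: the logic `L` is pretransitive with finite transitivity
index `m`, and `φ` is `B_h` with `◇^{≤m}` in place of `◇`. -/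
def IsHeightFormula (L : Set MFormula) (h : ℕ) (φ : MFormula) : Prop :=
  ∃ m : ℕ, transIndex L = m ∧ φ = (MFormula.heightFormula h).replaceDia m

/-- The height of `L`: the least `h` with `B_h^* ∈ L`; it is `⊤` if there is none, in particular
if `L` is not pretransitive. -/
noncomputable def height (L : Set MFormula) : ℕ∞ :=
  ⨅ (h : ℕ) (_ : ∃ φ ∈ L, IsHeightFormula L h φ), (h : ℕ∞)

/-- `L[h]`, the extension of a pretransitive logic `L` with its formula `B_h^*`. -/
def withHeight (L : Set MFormula) (h : ℕ) : Set MFormula :=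
  generatedBy (L ∪ {φ | IsHeightFormula L h φ})

/-- The least modal depth of a formula that is `L`-equivalent to `φ`. -/
noncomputable def formulaDepth (L : Set MFormula) (φ : MFormula) : ℕ∞ :=
  ⨅ (ψ : MFormula) (_ : MFormula.iff φ ψ ∈ L), (ψ.depth : ℕ∞)

/-- The modal depth of `L`. -/
noncomputable def modalDepth (L : Set MFormula) : ℕ∞ := ⨆ φ : MFormula, formulaDepth L φ

/-- There are only finitely many `L`-equivalence classes of `k`-formulas. -/
def IsKFinite (k : ℕ) (L : Set MFormula) : Prop :=
  {C : Set MFormula | ∃ φ : MFormula, φ.IsKFormula k ∧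
    C = {ψ | ψ.IsKFormula k ∧ MFormula.iff φ ψ ∈ L}}.Finite

def IsLocallyTabular (L : Set MFormula) : Prop := ∀ k : ℕ, IsKFinite k L

end NormalLogic

/-! A logic containing `wK4` is the set of formulas true throughout its canonical model, and by
`weaklyTransitive_rel` that model is weakly transitive: its reflexive closure is a preorder, whose
classes are called clusters. Everything is read off this model.

From finite height to finite depth. If all instances of `B_h^*` hold, strict chains of clusters have
at most `h` members (`heightLE_of_sat_subst`), because formulas separate a point from any cone that
misses it. By `NEquiv.of_heightLE`, `2h` rounds of bisimulation then already decide all further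
rounds: each layer of clusters costs two rounds, and inside a cluster agreement on the variables is
enough. A set closed under `2h`-bisimilarity is defined by a formula of depth at most `2h`, so the
modal depth is at most `2h`, which is at most `4h - 2` for positive `h`.

From finite depth to local tabularity. Over `k` variables there are finitely many formulas of depth
at most `d` up to equivalence.

From local tabularity to finite height. If every `B_n^*` fails, refutations provide long chains of
ranks. With `p₀` read as "the rank is even", the one-variable alternation formulas measure rank, so
they are pairwise inequivalent (`exists_not_sat_alternation_iff`).

The transitivity index may also be `0`. Then distinct worlds are unrelated and the height is at most
one. -/

namespace MFormula

/-- Satisfaction in the Kripke model on `W` with accessibility relation `R` and valuation `V`. -/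
def Sat {W : Type} (R : W → W → Prop) (V : ℕ → W → Prop) : MFormula → W → Prop
  | var n, x => V n x
  | bot, _ => False
  | imp φ ψ, x => Sat R V φ x → Sat R V ψ x
  | dia φ, x => ∃ y, R x y ∧ Sat R V φ y

/-! ### Kripke semantics, weak transitivity and height -/

section Semantics

open Relation

variable {W : Type} {R : W → W → Prop} {V : ℕ → W → Prop} {x y z : W}

@[simp] theorem sat_neg (φ : MFormula) : Sat R V (neg φ) x ↔ ¬ Sat R V φ x := Iff.rfl

@[simp] theorem sat_or (φ ψ : MFormula) :
    Sat R V (or φ ψ) x ↔ Sat R V φ x ∨ Sat R V ψ x := by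
  simp only [or, Sat, neg]; tauto

@[simp] theorem sat_and (φ ψ : MFormula) :
    Sat R V (and φ ψ) x ↔ Sat R V φ x ∧ Sat R V ψ x := by
  simp only [and, Sat, neg]; tauto

@[simp] theorem sat_iff (φ ψ : MFormula) :
    Sat R V (iff φ ψ) x ↔ (Sat R V φ x ↔ Sat R V ψ x) := by
  simp only [iff, sat_and, Sat]; tauto

theorem sat_diaLE_one (φ : MFormula) :
    Sat R V (diaLE 1 φ) x ↔ ∃ y, ReflGen R x y ∧ Sat R V φ y := by
  simp only [diaLE, diaPow, sat_or, Sat, reflGen_iff]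
  constructor
  · rintro (h | ⟨y, hy, h⟩)
    exacts [⟨x, .inl rfl, h⟩, ⟨y, .inr hy, h⟩]
  · rintro ⟨y, rfl | hy, h⟩
    exacts [.inl h, .inr ⟨y, hy, h⟩]

theorem sat_subst (s : ℕ → MFormula) (φ : MFormula) :
    Sat R V (φ.subst s) x ↔ Sat R (fun n => Sat R V (s n)) φ x := by
  induction φ generalizing x with
  | var n => rfl
  | bot => rfl
  | imp φ ψ hφ hψ => simp only [subst, Sat, hφ, hψ]
  | dia φ hφ => simp only [subst, Sat, hφ]

theorem sat_heightFormula_succ (h : ℕ) :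
    Sat R V ((heightFormula (h + 1)).replaceDia 1) x ↔
      (V (h + 1) x → ∀ y, ReflGen R x y → (∃ z, ReflGen R y z ∧ V (h + 1) z) ∨
        Sat R V ((heightFormula h).replaceDia 1) y) := by
  change (V (h + 1) x → ¬ Sat R V (diaLE 1 (neg (or (diaLE 1 (var (h + 1)))
    ((heightFormula h).replaceDia 1)))) x) ↔ _
  simp only [sat_diaLE_one, sat_neg, sat_or, not_exists, not_and, not_not]
  rfl

theorem sat_heightFormula_congr {V' : ℕ → W → Prop} (h : ℕ) (hV : ∀ i ≤ h, V i = V' i) :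
    Sat R V ((heightFormula h).replaceDia 1) x ↔ Sat R V' ((heightFormula h).replaceDia 1) x := by
  induction h generalizing x with
  | zero => rfl
  | succ h ih =>
    have ih' := fun y => ih (x := y) fun i hi => hV i (by omega)
    simp only [sat_heightFormula_succ, ih', hV (h + 1) le_rfl]

/-- Weak transitivity. -/
def WeaklyTransitive (R : W → W → Prop) : Prop := ∀ x y z, R x y → R y z → R x z ∨ x = z

theorem WeaklyTransitive.reflGen_trans (hR : WeaklyTransitive R) (hxy : ReflGen R x y)
    (hyz : ReflGen R y z) : ReflGen R x z := by
  rw [reflGen_iff] at *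
  rcases hxy with rfl | hxy
  · exact hyz
  rcases hyz with rfl | hyz
  · exact .inr hxy
  · exact (hR x y z hxy hyz).elim .inr fun h => .inl h.symm

theorem rel_of_reflGen (h : ReflGen R x y) (hne : x ≠ y) : R x y := by
  rw [reflGen_iff] at h
  exact h.resolve_left fun e => hne e.symm

/-- All strictly descending chains of clusters that start at `x` have at most `h` members. -/
def HeightLE (R : W → W → Prop) : ℕ → W → Prop
  | 0, _ => False
  | h + 1, x => ∀ y, ReflGen R x y → ¬ ReflGen R y x → HeightLE R h y

/-- In a model where formulas separate points from clusters that do not see them, a point at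
which all substitution instances of `B_h^*` are true has height at most `h`. -/
theorem heightLE_of_sat_subst
    (hsep : ∀ x y, ¬ ReflGen R y x → ∃ φ, Sat R V φ x ∧ ∀ z, ReflGen R y z → ¬ Sat R V φ z)
    (h : ℕ) (hx : ∀ s, Sat R V (((heightFormula h).replaceDia 1).subst s) x) :
    HeightLE R h x := by
  by_contra hc
  suffices ∃ s : ℕ → MFormula,
      ¬ Sat R (fun n => Sat R V (s n)) ((heightFormula h).replaceDia 1) x by
    obtain ⟨s, hs⟩ := this
    exact hs ((sat_subst _ _).1 (hx s))
  clear hx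
  induction h generalizing x with
  | zero => exact ⟨var, id⟩
  | succ h ih =>
    simp only [HeightLE, not_forall] at hc
    obtain ⟨y, hxy, hyx, hy⟩ := hc
    obtain ⟨s, hs⟩ := ih hy
    obtain ⟨φ, hφ, hn⟩ := hsep x y hyx
    -- The variable `p_{h+1}` does not occur in `B_h`, so its value can be changed without spoiling
    -- the refutation at `y`.
    refine ⟨Function.update s (h + 1) φ, ?_⟩
    rw [sat_heightFormula_succ]
    intro H
    rcases H (by simpa using hφ) y hxy with ⟨z, hyz, hz⟩ | H
    · exact hn z hyz (by simpa using hz)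
    · refine hs ((sat_heightFormula_congr h fun i hi => ?_).1 H)
      simp only [Function.update_of_ne (show i ≠ h + 1 by omega)]

/-! ### Bisimulation games on models of finite height -/

/-- `n`-bisimilarity with respect to the variables `pᵢ`, `i < k`. -/
def NEquiv (R : W → W → Prop) (V : ℕ → W → Prop) (k : ℕ) : ℕ → W → W → Prop
  | 0, x, y => ∀ i < k, V i x ↔ V i y
  | n + 1, x, y => (∀ i < k, V i x ↔ V i y) ∧
      (∀ x', R x x' → ∃ y', R y y' ∧ NEquiv R V k n x' y') ∧
      (∀ y', R y y' → ∃ x', R x x' ∧ NEquiv R V k n x' y')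

namespace NEquiv

variable {k n : ℕ}

theorem var (h : NEquiv R V k n x y) : ∀ i < k, V i x ↔ V i y := by
  cases n with
  | zero => exact h
  | succ n => exact h.1

theorem refl (n : ℕ) (x : W) : NEquiv R V k n x x := by
  induction n generalizing x with
  | zero => exact fun _ _ => Iff.rfl
  | succ n ih => exact ⟨fun _ _ => Iff.rfl, fun z hz => ⟨z, hz, ih z⟩, fun z hz => ⟨z, hz, ih z⟩⟩

theorem symm (h : NEquiv R V k n x y) : NEquiv R V k n y x := by
  induction n generalizing x y with
  | zero => exact fun i hi => (h i hi).symm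
  | succ n ih =>
    refine ⟨fun i hi => (h.1 i hi).symm, fun z hz => ?_, fun z hz => ?_⟩
    · obtain ⟨w, hw, e⟩ := h.2.2 z hz
      exact ⟨w, hw, ih e⟩
    · obtain ⟨w, hw, e⟩ := h.2.1 z hz
      exact ⟨w, hw, ih e⟩

theorem trans (h : NEquiv R V k n x y) (h' : NEquiv R V k n y z) : NEquiv R V k n x z := by
  induction n generalizing x y z with
  | zero => exact fun i hi => (h i hi).trans (h' i hi)
  | succ n ih =>
    refine ⟨fun i hi => (h.1 i hi).trans (h'.1 i hi), fun u hu => ?_, fun u hu => ?_⟩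
    · obtain ⟨v, hv, e⟩ := h.2.1 u hu
      obtain ⟨w, hw, e'⟩ := h'.2.1 v hv
      exact ⟨w, hw, ih e e'⟩
    · obtain ⟨v, hv, e⟩ := h'.2.2 u hu
      obtain ⟨w, hw, e'⟩ := h.2.2 v hv
      exact ⟨w, hw, ih e' e⟩

theorem pred (h : NEquiv R V k (n + 1) x y) : NEquiv R V k n x y := by
  induction n generalizing x y with
  | zero => exact h.1
  | succ n ih =>
    refine ⟨h.1, fun z hz => ?_, fun z hz => ?_⟩
    · obtain ⟨w, hw, e⟩ := h.2.1 z hz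
      exact ⟨w, hw, ih e⟩
    · obtain ⟨w, hw, e⟩ := h.2.2 z hz
      exact ⟨w, hw, ih e⟩

theorem sat_iff (h : NEquiv R V k n x y) {φ : MFormula} (hk : φ.IsKFormula k)
    (hd : φ.depth ≤ n) : Sat R V φ x ↔ Sat R V φ y := by
  induction φ generalizing n x y with
  | var i => exact h.var i hk
  | bot => rfl
  | imp φ ψ hφ hψ =>
    simp only [depth, sup_le_iff] at hd
    simp only [Sat, hφ h hk.1 hd.1, hψ h hk.2 hd.2]
  | dia φ ih =>
    simp only [depth] at hd
    obtain ⟨n, rfl⟩ : ∃ m, n = m + 1 := ⟨n - 1, by omega⟩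
    constructor
    · rintro ⟨z, hz, hs⟩
      obtain ⟨w, hw, e⟩ := h.2.1 z hz
      exact ⟨w, hw, (ih e hk (by omega)).1 hs⟩
    · rintro ⟨z, hz, hs⟩
      obtain ⟨w, hw, e⟩ := h.2.2 z hz
      exact ⟨w, hw, (ih e hk (by omega)).2 hs⟩

/-- Points of one cluster that agree on the variables are `m`-bisimilar for all `m`. -/
theorem of_cluster (hR : WeaklyTransitive R) (hxy : ReflGen R x y) (hyx : ReflGen R y x)
    (hV : ∀ i < k, V i x ↔ V i y) (m : ℕ) : NEquiv R V k m x y := by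
  induction m generalizing x y with
  | zero => exact hV
  | succ m ih =>
    have key : ∀ {x y : W}, ReflGen R x y → ReflGen R y x → (∀ i < k, V i x ↔ V i y) →
        ∀ z, R x z → ∃ w, R y w ∧ NEquiv R V k m z w := by
      intro x y hxy hyx hV z hz
      -- A successor `z` of `x` answers for itself unless it is `y`, which need not see itself; then
      -- `x` is the answer.
      by_cases hyz : y = z
      · subst hyz
        by_cases e : y = x
        · subst e
          exact ⟨y, hz, refl m y⟩
        · exact ⟨x, rel_of_reflGen hyx e, ih hyx hxy fun i hi => (hV i hi).symm⟩
      · exact ⟨z, rel_of_reflGen (hR.reflGen_trans hyx (.single hz)) hyz, refl m z⟩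
    refine ⟨hV, key hxy hyx hV, fun z hz => ?_⟩
    obtain ⟨w, hw, e⟩ := key hyx hxy (fun i hi => (hV i hi).symm) z hz
    exact ⟨w, hw, e.symm⟩

/-- In weakly transitive models, `2h`-bisimilarity to a point of height at most `h` implies
`m`-bisimilarity for all `m`. -/
theorem of_heightLE (hR : WeaklyTransitive R) (h : ℕ) (hx : HeightLE R h x)
    (hxy : NEquiv R V k (2 * h) x y) (m : ℕ) : NEquiv R V k m x y := by
  induction h generalizing x y m with
  | zero => exact hx.elim
  | succ h ih =>
    have hxy : NEquiv R V k (2 * h + 1 + 1) x y := hxy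
    generalize hn : 2 * h = n at hxy ih
    have old : ∀ {d w}, ReflGen R x d → ¬ ReflGen R d x → NEquiv R V k n d w →
        ∀ m, NEquiv R V k m d w := fun h₁ h₂ e => ih (hx _ h₁ h₂) e
    -- One of the two extra rounds is spent here. The other lets a point of the cluster of `x` be
    -- told apart by its successors up to `n`-bisimilarity.
    have lift : ∀ w, ReflGen R y w → ∃ u, ReflGen R x u ∧ NEquiv R V k (n + 1) u w := by
      intro w hw
      rcases (reflGen_iff _ _ _).1 hw with rfl | hw
      · exact ⟨x, .refl, hxy.pred⟩
      · obtain ⟨u, hu, e⟩ := hxy.2.2 w hw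
        exact ⟨u, .single hu, e⟩
    suffices ∀ m u z, ReflGen R x u → ReflGen R u x → ReflGen R y z →
        NEquiv R V k (n + 1) u z → NEquiv R V k m u z from
      this m x y .refl .refl .refl hxy.pred
    intro m
    induction m with
    | zero => exact fun u z _ _ _ e => e.1
    | succ m ihm =>
      intro u z hxu hux hyz e
      have cluster : ∀ {v v'}, ReflGen R x v → ReflGen R v x → ReflGen R x v' → ReflGen R v' x →
          (∀ i < k, V i v ↔ V i v') → ∀ m, NEquiv R V k m v v' := fun h₁ h₂ h₃ h₄ hV =>
        of_cluster hR (hR.reflGen_trans h₂ h₃) (hR.reflGen_trans h₄ h₁) hV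
      refine ⟨e.1, fun u' hu' => ?_, fun w hw => ?_⟩
      · obtain ⟨w, hw, e'⟩ := e.2.1 u' hu'
        refine ⟨w, hw, ?_⟩
        have hxu' := hR.reflGen_trans hxu (.single hu')
        by_cases hu'x : ReflGen R u' x
        · have hyw := hR.reflGen_trans hyz (.single hw)
          obtain ⟨v, hxv, e''⟩ := lift w hyw
          by_cases hvx : ReflGen R v x
          · refine ihm u' w hxu' hu'x hyw (trans ?_ e'')
            exact cluster hxu' hu'x hxv hvx
              (fun i hi => (e'.var i hi).trans (e''.var i hi).symm) _
          -- Here `v` lies strictly below `x` and is `n`-bisimilar to both `u'` and `w`, so the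
          -- induction on height applies to both pairs.
          · exact (old hxv hvx (e''.pred.trans e'.symm) m).symm.trans (old hxv hvx e''.pred m)
        · exact old hxu' hu'x e' m
      · have hyw := hR.reflGen_trans hyz (.single hw)
        obtain ⟨v, hxv, e''⟩ := lift w hyw
        by_cases hvx : ReflGen R v x
        · obtain ⟨u', hu', e'⟩ := e.2.2 w hw
          refine ⟨u', hu', ?_⟩
          have hxu' := hR.reflGen_trans hxu (.single hu')
          by_cases hu'x : ReflGen R u' x
          · refine ihm u' w hxu' hu'x hyw (trans ?_ e'')
            exact cluster hxu' hu'x hxv hvx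
              (fun i hi => (e'.var i hi).trans (e''.var i hi).symm) _
          · exact old hxu' hu'x e' m
        · refine ⟨v, rel_of_reflGen (hR.reflGen_trans hux hxv) ?_, old hxv hvx e''.pred m⟩
          rintro rfl
          exact hvx hux

end NEquiv

end Semantics

/-! ### Formulas that define bisimilarity types -/

/-- Finite disjunctions. -/
def disj : List MFormula → MFormula
  | [] => bot
  | φ :: l => or φ (disj l)

/-- The conjunctions that decide each formula of the list. -/
def atoms : List MFormula → List MFormula
  | [] => [neg bot]
  | φ :: l => (atoms l).map (and φ) ++ (atoms l).map (and (neg φ))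

/-- Formulas whose truth values determine a point up to `n`-bisimilarity. -/
def typeFormulas (k : ℕ) : ℕ → List MFormula
  | 0 => (List.range k).map var
  | n + 1 => (List.range k).map var ++ (atoms (typeFormulas k n)).map dia

theorem depth_disj_le {n : ℕ} {l : List MFormula} (h : ∀ φ ∈ l, φ.depth ≤ n) :
    (disj l).depth ≤ n := by
  induction l with
  | nil => exact Nat.zero_le _
  | cons φ l ih =>
    have := ih fun ψ hψ => h ψ (List.mem_cons_of_mem _ hψ)
    have := h φ List.mem_cons_self
    simp only [disj, or, neg, depth]
    omega

theorem depth_le_of_mem_atoms {n : ℕ} {l : List MFormula} (h : ∀ φ ∈ l, φ.depth ≤ n) :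
    ∀ φ ∈ atoms l, φ.depth ≤ n := by
  induction l with
  | nil => simp [atoms, neg, depth]
  | cons φ l ih =>
    have ih := ih fun ψ hψ => h ψ (List.mem_cons_of_mem _ hψ)
    have := h φ List.mem_cons_self
    intro ψ hψ
    simp only [atoms, List.mem_append, List.mem_map] at hψ
    rcases hψ with ⟨χ, hχ, rfl⟩ | ⟨χ, hχ, rfl⟩ <;>
    · have := ih χ hχ
      simp only [and, neg, depth]
      omega

theorem depth_le_of_mem_typeFormulas (k n : ℕ) : ∀ φ ∈ typeFormulas k n, φ.depth ≤ n := by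
  induction n with
  | zero =>
    intro φ hφ
    simp only [typeFormulas, List.mem_map] at hφ
    obtain ⟨i, -, rfl⟩ := hφ
    exact le_rfl
  | succ n ih =>
    intro φ hφ
    simp only [typeFormulas, List.mem_append, List.mem_map] at hφ
    rcases hφ with ⟨i, -, rfl⟩ | ⟨ψ, hψ, rfl⟩
    · exact Nat.zero_le _
    · exact Nat.succ_le_succ (depth_le_of_mem_atoms ih ψ hψ)

section Types

variable {W : Type} {R : W → W → Prop} {V : ℕ → W → Prop} {x y : W}

theorem sat_disj (l : List MFormula) : Sat R V (disj l) x ↔ ∃ φ ∈ l, Sat R V φ x := by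
  induction l with
  | nil => simp [disj, Sat]
  | cons φ l ih => simp [disj, ih]

theorem exists_mem_atoms (l : List MFormula) (x : W) : ∃ φ ∈ atoms l, Sat R V φ x := by
  induction l with
  | nil => exact ⟨_, List.mem_singleton_self _, id⟩
  | cons φ l ih =>
    obtain ⟨ψ, hψ, hs⟩ := ih
    by_cases h : Sat R V φ x
    · exact ⟨and φ ψ, List.mem_append_left _ (List.mem_map_of_mem hψ), by simp [h, hs]⟩
    · exact ⟨and (neg φ) ψ, List.mem_append_right _ (List.mem_map_of_mem hψ), by simp [h, hs]⟩

theorem sat_iff_of_mem_atoms {l : List MFormula} {ψ : MFormula} (hψ : ψ ∈ atoms l)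
    (hx : Sat R V ψ x) (hy : Sat R V ψ y) : ∀ φ ∈ l, Sat R V φ x ↔ Sat R V φ y := by
  induction l generalizing ψ with
  | nil => simp
  | cons χ l ih =>
    simp only [atoms, List.mem_append, List.mem_map] at hψ
    intro φ hφ
    rcases hψ with ⟨ψ, hψ, rfl⟩ | ⟨ψ, hψ, rfl⟩ <;>
    · simp only [sat_and, sat_neg] at hx hy
      rcases List.mem_cons.1 hφ with rfl | hφ
      · tauto
      · exact ih hψ hx.2 hy.2 φ hφ

theorem nEquiv_of_typeFormulas {k n : ℕ}
    (h : ∀ φ ∈ typeFormulas k n, Sat R V φ x ↔ Sat R V φ y) : NEquiv R V k n x y := by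
  induction n generalizing x y with
  | zero => exact fun i hi => h (var i) (List.mem_map_of_mem (List.mem_range.2 hi))
  | succ n ih =>
    have key : ∀ {x y : W}, (∀ φ ∈ typeFormulas k (n + 1), Sat R V φ x ↔ Sat R V φ y) →
        ∀ z, R x z → ∃ w, R y w ∧ NEquiv R V k n z w := by
      intro x y h z hz
      obtain ⟨ψ, hψ, hs⟩ := exists_mem_atoms (R := R) (V := V) (typeFormulas k n) z
      obtain ⟨w, hw, hs'⟩ :=
        (h (dia ψ) (List.mem_append_right _ (List.mem_map_of_mem hψ))).1 ⟨z, hz, hs⟩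
      exact ⟨w, hw, ih (sat_iff_of_mem_atoms hψ hs hs')⟩
    refine ⟨fun i hi => h (var i)
      (List.mem_append_left _ (List.mem_map_of_mem (List.mem_range.2 hi))), key h, fun z hz => ?_⟩
    obtain ⟨w, hw, e⟩ := key (fun φ hφ => (h φ hφ).symm) z hz
    exact ⟨w, hw, e.symm⟩

/-- A set of points that is closed under `n`-bisimilarity is defined by a disjunction of
members of a fixed finite list of formulas of depth at most `n`. -/
theorem exists_sublist_sat_iff {k n : ℕ} {U : W → Prop}
    (hU : ∀ x y, NEquiv R V k n x y → U x → U y) :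
    ∃ l ∈ (atoms (typeFormulas k n)).sublists, ∀ x, Sat R V (disj l) x ↔ U x := by
  classical
  refine ⟨(atoms (typeFormulas k n)).filter fun φ => ∃ x, Sat R V φ x ∧ U x,
    List.mem_sublists.2 List.filter_sublist, fun x => ?_⟩
  simp only [sat_disj, List.mem_filter, decide_eq_true_eq]
  constructor
  · rintro ⟨φ, ⟨hφ, y, hy, hU'⟩, hx⟩
    exact hU y x (nEquiv_of_typeFormulas (sat_iff_of_mem_atoms hφ hy hx)) hU'
  · intro hx
    obtain ⟨φ, hφ, hs⟩ := exists_mem_atoms (R := R) (V := V) (typeFormulas k n) x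
    exact ⟨φ, ⟨hφ, x, hs, hx⟩, hs⟩

theorem depth_disj_le_of_mem_sublists {k n : ℕ} {l : List MFormula}
    (hl : l ∈ (atoms (typeFormulas k n)).sublists) : (disj l).depth ≤ n :=
  depth_disj_le fun φ hφ => depth_le_of_mem_atoms (depth_le_of_mem_typeFormulas k n) φ
    ((List.mem_sublists.1 hl).subset hφ)

end Types

/-! ### Alternation along chains -/

/-- Alternation of `p₀` along `◇^{≤1}`: it forces a chain of length `n`. -/
def alternation : ℕ → MFormula
  | 0 => neg bot
  | n + 1 => and (if Even (n + 1) then var 0 else neg (var 0)) (diaLE 1 (alternation n))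

/-- The formula which says that the largest `i ≤ h` such that `◇^{≤1}pᵢ` holds is even. -/
def evenRank : ℕ → MFormula
  | 0 => neg bot
  | h + 1 => or (and (diaLE 1 (var (h + 1))) (if Even (h + 1) then neg bot else bot))
      (and (neg (diaLE 1 (var (h + 1)))) (evenRank h))

theorem isKFormula_alternation (n : ℕ) : (alternation n).IsKFormula 1 := by
  induction n with
  | zero => exact ⟨trivial, trivial⟩
  | succ n ih =>
    simp only [alternation, and, diaLE, diaPow, or, neg, IsKFormula]
    split_ifs <;> simp [IsKFormula, ih]

section Alternation

open Relation

variable {W : Type} {R : W → W → Prop} {V : ℕ → W → Prop} {x y : W}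

open Classical in
/-- The largest `i ≤ h` such that `pᵢ` holds at a point of the cone of `x`, or `0`. -/
noncomputable def chainRank (R : W → W → Prop) (V : ℕ → W → Prop) : ℕ → W → ℕ
  | 0, _ => 0
  | h + 1, x => if ∃ y, ReflGen R x y ∧ V (h + 1) y then h + 1 else chainRank R V h x

theorem chainRank_le (h : ℕ) (x : W) : chainRank R V h x ≤ h := by
  induction h with
  | zero => exact le_rfl
  | succ h ih => rw [chainRank]; split_ifs <;> omega

theorem chainRank_anti (hR : WeaklyTransitive R) (h : ℕ) (hxy : ReflGen R x y) :
    chainRank R V h y ≤ chainRank R V h x := by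
  induction h with
  | zero => exact le_rfl
  | succ h ih =>
    have := chainRank_le (R := R) (V := V) h y
    simp only [chainRank]
    split_ifs with h₁ h₂ h₂
    · rfl
    · obtain ⟨z, hz, hv⟩ := h₁
      exact (h₂ ⟨z, hR.reflGen_trans hxy hz, hv⟩).elim
    · omega
    · exact ih

/-- The case `i = 0` needs no witness, since `0` is the default rank. -/
theorem chainRank_eq {h i : ℕ} (hi : i ≤ h) (hx : i = 0 ∨ V i x)
    (hj : ∀ j, i < j → j ≤ h → ∀ y, ReflGen R x y → ¬ V j y) : chainRank R V h x = i := by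
  induction h with
  | zero => rw [chainRank]; omega
  | succ h ih =>
    rw [chainRank]
    rcases Nat.lt_or_ge i (h + 1) with hlt | hge
    · rw [if_neg]
      · exact ih (by omega) fun j h₁ h₂ => hj j h₁ (by omega)
      · rintro ⟨y, hy, hv⟩
        exact hj (h + 1) hlt le_rfl y hy hv
    · obtain rfl : i = h + 1 := by omega
      rw [if_pos ⟨x, .refl, hx.resolve_left (by omega)⟩]

theorem sat_evenRank (h : ℕ) : Sat R V (evenRank h) x ↔ Even (chainRank R V h x) := by
  induction h with
  | zero => simp [evenRank, chainRank, Sat]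
  | succ h ih =>
    simp only [evenRank, chainRank, sat_or, sat_and, sat_neg, sat_diaLE_one, ih]
    have hV : ∀ y, Sat R V (var (h + 1)) y ↔ V (h + 1) y := fun _ => Iff.rfl
    simp only [hV]
    by_cases h₁ : ∃ y, ReflGen R x y ∧ V (h + 1) y
    · by_cases h₂ : Even (h + 1) <;> simp [h₁, h₂, Sat]
    · simp [h₁]

theorem sat_alternation_succ (n : ℕ) : Sat R V (alternation (n + 1)) x ↔
    (Even (n + 1) ↔ V 0 x) ∧ ∃ y, ReflGen R x y ∧ Sat R V (alternation n) y := by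
  have hV : Sat R V (var 0) x ↔ V 0 x := Iff.rfl
  rw [alternation, sat_and, sat_diaLE_one]
  by_cases h : Even (n + 1) <;> simp [h, hV]

variable {r : W → ℕ}

theorem le_of_sat_alternation (hr : ∀ x y, ReflGen R x y → r y ≤ r x)
    (hV : ∀ x, V 0 x ↔ Even (r x)) (n : ℕ) (hx : Sat R V (alternation n) x) : n ≤ r x := by
  induction n generalizing x with
  | zero => exact Nat.zero_le _
  | succ n ih =>
    obtain ⟨he, y, hy, hs⟩ := (sat_alternation_succ n).1 hx
    have := ih hs
    have := hr x y hy
    rcases Nat.lt_or_ge n (r x) with h | h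
    · exact h
    · obtain rfl : n = r x := by omega
      -- Rank `n` has the wrong parity for step `n + 1` of the alternation, which forces the strict
      -- increase.
      rw [hV, Nat.even_add_one] at he
      tauto

/-- The refutation of `B_i^*` gives points of all ranks up to `i`. -/
theorem sat_alternation_of_not_sat (hR : WeaklyTransitive R) {V' : ℕ → W → Prop} {h : ℕ}
    (hV : ∀ x, V' 0 x ↔ Even (chainRank R V h x)) (i : ℕ) (hi : i ≤ h)
    (hx : ¬ Sat R V ((heightFormula i).replaceDia 1) x)
    (hj : ∀ j, i < j → j ≤ h → ∀ y, ReflGen R x y → ¬ V j y) :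
    Sat R V' (alternation i) x ∧
      ∀ m ≤ i, ∃ y, Sat R V' (alternation m) y ∧ chainRank R V h y = m := by
  induction i generalizing x with
  | zero =>
    refine ⟨id, fun m hm => ⟨x, ?_, ?_⟩⟩
    · obtain rfl : m = 0 := by omega
      exact id
    · obtain rfl : m = 0 := by omega
      exact chainRank_eq hi (.inl rfl) hj
  | succ i ih =>
    rw [sat_heightFormula_succ] at hx
    push Not at hx
    obtain ⟨hp, y, hxy, hyp, hy⟩ := hx
    have hr := chainRank_eq hi (.inr hp) hj
    obtain ⟨h₁, h₂⟩ := ih (by omega) hy fun j hj₁ hj₂ z hz => by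
      rcases Nat.lt_or_ge (i + 1) j with hlt | hge
      · exact hj j hlt hj₂ z (hR.reflGen_trans hxy hz)
      · obtain rfl : j = i + 1 := by omega
        exact hyp z hz
    have h₃ : Sat R V' (alternation (i + 1)) x :=
      (sat_alternation_succ i).2 ⟨by rw [hV, hr], y, hxy, h₁⟩
    refine ⟨h₃, fun m hm => ?_⟩
    rcases Nat.lt_or_ge i m with hlt | hge
    · obtain rfl : m = i + 1 := by omega
      exact ⟨x, h₃, hr⟩
    · exact h₂ m hge

/-- If `B_n^*` fails in a weakly transitive model, then so does a substitution instance of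
the equivalence of any two alternation formulas of lengths `m < n`. -/
theorem exists_not_sat_alternation_iff (hR : WeaklyTransitive R) {m n : ℕ} (hmn : m < n)
    (hx : ¬ Sat R V ((heightFormula n).replaceDia 1) x) :
    ∃ y, ¬ Sat R V ((iff (alternation m) (alternation n)).subst fun _ => evenRank n) y := by
  have hV : ∀ x, (fun _ : ℕ => Sat R V (evenRank n)) 0 x ↔ Even (chainRank R V n x) :=
    fun x => sat_evenRank n
  obtain ⟨y, hy, hr⟩ := (sat_alternation_of_not_sat hR (V' := fun _ => Sat R V (evenRank n)) hV n
    le_rfl hx fun j h₁ h₂ => by omega).2 m hmn.le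
  refine ⟨y, fun hs => ?_⟩
  rw [sat_subst, sat_iff] at hs
  have := le_of_sat_alternation (V := fun _ => Sat R V (evenRank n))
    (fun _ _ => chainRank_anti hR n) hV n (hs.1 hy)
  omega

end Alternation

/-! ### Restricting the variables -/

theorem IsKFormula.mono {k l : ℕ} (hkl : k ≤ l) {φ : MFormula} (h : φ.IsKFormula k) :
    φ.IsKFormula l := by
  induction φ with
  | var n => exact lt_of_lt_of_le h hkl
  | bot => trivial
  | imp φ ψ hφ hψ => exact ⟨hφ h.1, hψ h.2⟩
  | dia φ ih => exact ih h

theorem exists_isKFormula (φ : MFormula) : ∃ k, φ.IsKFormula k := by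
  induction φ with
  | var n => exact ⟨n + 1, Nat.lt_succ_self n⟩
  | bot => exact ⟨0, trivial⟩
  | imp φ ψ hφ hψ =>
    obtain ⟨k, hk⟩ := hφ
    obtain ⟨l, hl⟩ := hψ
    exact ⟨max k l, hk.mono (le_max_left _ _), hl.mono (le_max_right _ _)⟩
  | dia φ ih => exact ih

/-- The substitution of `⊥` for the variables `pᵢ`, `i ≥ k`. -/
def truncate (k n : ℕ) : MFormula := if n < k then var n else bot

theorem IsKFormula.subst_truncate {k : ℕ} {φ : MFormula} (h : φ.IsKFormula k) :
    φ.subst (truncate k) = φ := by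
  induction φ with
  | var n => exact if_pos h
  | bot => rfl
  | imp φ ψ hφ hψ => simp only [subst, hφ h.1, hψ h.2]
  | dia φ ih => simp only [subst, ih h]

theorem isKFormula_subst_truncate (k : ℕ) (φ : MFormula) :
    (φ.subst (truncate k)).IsKFormula k := by
  induction φ with
  | var n =>
    simp only [subst, truncate]
    split_ifs with h
    exacts [h, trivial]
  | bot => trivial
  | imp φ ψ hφ hψ => exact ⟨hφ, hψ⟩
  | dia φ ih => exact ih

theorem depth_subst_truncate_le (k : ℕ) (φ : MFormula) :
    (φ.subst (truncate k)).depth ≤ φ.depth := by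
  induction φ with
  | var n =>
    simp only [subst, truncate]
    split_ifs <;> simp [depth]
  | bot => exact le_rfl
  | imp φ ψ hφ hψ => exact max_le_max hφ hψ
  | dia φ ih => exact Nat.succ_le_succ ih

end MFormula

namespace NormalLogic

open MFormula Relation

variable {L : Set MFormula}

/-! ### The canonical model -/

/-- Maximal consistent theories of `L`. -/
@[ext] structure World (L : Set MFormula) where
  carrier : Set MFormula
  subset : L ⊆ carrier
  mp : ∀ φ ψ, MFormula.imp φ ψ ∈ carrier → φ ∈ carrier → ψ ∈ carrier
  consistent : MFormula.bot ∉ carrier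
  complete : ∀ φ, φ ∈ carrier ∨ MFormula.neg φ ∈ carrier

/-- Lindenbaum's lemma: a theory maximal among those omitting `φ` is complete, since `ψ` and `¬ψ`
cannot both imply `φ`. -/
theorem exists_world (hL : IsNormalLogic L) {T : Set MFormula} (hLT : L ⊆ T)
    (hT : ∀ φ ψ, MFormula.imp φ ψ ∈ T → φ ∈ T → ψ ∈ T) {φ : MFormula} (hφ : φ ∉ T) :
    ∃ w : World L, T ⊆ w.carrier ∧ φ ∉ w.carrier := by
  obtain ⟨M, hTM, hM⟩ := zorn_subset_nonempty
    {T | L ⊆ T ∧ (∀ φ ψ, MFormula.imp φ ψ ∈ T → φ ∈ T → ψ ∈ T) ∧ φ ∉ T} (fun c hc hch hne => by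
      refine ⟨⋃₀ c, ⟨?_, ?_, ?_⟩, fun s hs => Set.subset_sUnion_of_mem hs⟩
      · obtain ⟨s, hs⟩ := hne
        exact (hc hs).1.trans (Set.subset_sUnion_of_mem hs)
      · rintro ψ χ ⟨s, hs, h₁⟩ ⟨t, ht, h₂⟩
        rcases hch.total hs ht with hst | hst
        · exact ⟨t, ht, (hc ht).2.1 ψ χ (hst h₁) h₂⟩
        · exact ⟨s, hs, (hc hs).2.1 ψ χ h₁ (hst h₂)⟩
      · rintro ⟨s, hs, h⟩
        exact (hc hs).2.2 h) T ⟨hLT, hT, hφ⟩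
  obtain ⟨⟨hLM, hmp, hφM⟩, hmax⟩ := hM
  have taut : ∀ {ψ : MFormula}, ψ.IsTautology → ψ ∈ M := fun h => hLM (hL.taut _ h)
  have key : ∀ ψ, ψ ∉ M → MFormula.imp ψ φ ∈ M := by
    intro ψ hψ
    by_contra hc
    have hsub : M ⊆ {χ | MFormula.imp ψ χ ∈ M} := fun χ hχ =>
      hmp _ _ (taut (by intro v d; simp only [boolEval]; tauto)) hχ
    refine hψ (hmax (y := {χ | MFormula.imp ψ χ ∈ M}) ⟨hLM.trans hsub, fun α β h₁ h₂ => ?_, hc⟩ hsub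
      (taut (by intro v d; simp only [boolEval]; tauto)))
    exact hmp _ _ (hmp _ _ (taut (ψ := MFormula.imp (MFormula.imp ψ (MFormula.imp α β))
      (MFormula.imp (MFormula.imp ψ α) (MFormula.imp ψ β)))
      (by intro v d; simp only [boolEval]; tauto)) h₁) h₂
  refine ⟨⟨M, hLM, hmp, fun h => hφM ?_, fun ψ => ?_⟩, hTM, hφM⟩
  · exact hmp _ _ (taut (by intro v d; simp only [boolEval]; tauto)) h
  · by_contra! hc
    exact hφM (hmp _ _ (hmp _ _ (taut (ψ := MFormula.imp (MFormula.imp ψ φ)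
      (MFormula.imp (MFormula.imp (MFormula.neg ψ) φ) φ))
      (by intro v d; simp only [boolEval, MFormula.neg]; tauto)) (key _ hc.1)) (key _ hc.2))

namespace World

variable (x y z : World L) {φ ψ : MFormula}

/-- Accessibility in the canonical model. -/
def Rel (x y : World L) : Prop := ∀ φ ∈ y.carrier, MFormula.dia φ ∈ x.carrier

/-- The canonical valuation. -/
def Val (n : ℕ) (x : World L) : Prop := MFormula.var n ∈ x.carrier

theorem mem_neg : MFormula.neg φ ∈ x.carrier ↔ φ ∉ x.carrier :=
  ⟨fun h h' => x.consistent (x.mp _ _ h h'), (x.complete φ).resolve_left⟩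

theorem mem_imp (hL : IsNormalLogic L) :
    MFormula.imp φ ψ ∈ x.carrier ↔ (φ ∈ x.carrier → ψ ∈ x.carrier) := by
  refine ⟨x.mp φ ψ, fun h => ?_⟩
  by_cases hφ : φ ∈ x.carrier
  · exact x.mp _ _ (x.subset (hL.taut _ (by intro v d; simp only [boolEval]; tauto))) (h hφ)
  · exact x.mp _ _ (x.subset (hL.taut _ (by
      intro v d; simp only [boolEval, MFormula.neg]; tauto))) ((mem_neg x).2 hφ)

theorem exists_rel (hL : IsNormalLogic L) (h : MFormula.dia φ ∈ x.carrier) :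
    ∃ y : World L, Rel x y ∧ φ ∈ y.carrier := by
  have mono : ∀ {α β : MFormula}, (MFormula.imp α β).IsTautology →
      MFormula.dia α ∈ x.carrier → MFormula.dia β ∈ x.carrier := fun ht =>
    x.mp _ _ (x.subset (hL.mono _ _ (hL.taut _ ht)))
  -- In effect, `ψ` is in `T` when `□(φ → ψ)` is in `x`. So `T` contains `φ` and all boxed
  -- consequences of `x`, and `◇φ ∈ x` makes it consistent.
  let T : Set MFormula := {ψ | MFormula.dia (MFormula.and φ (MFormula.neg ψ)) ∉ x.carrier}
  have hLT : L ⊆ T := by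
    intro ψ hψ h'
    refine (mem_neg x).1 (x.subset hL.dia_bot) (x.mp _ _ (x.subset (hL.mono _ _ ?_)) h')
    refine hL.mp _ _ (hL.taut _ ?_) hψ
    intro v d; simp only [boolEval, MFormula.neg, MFormula.and]; tauto
  have hT : ∀ α β, MFormula.imp α β ∈ T → α ∈ T → β ∈ T := by
    intro α β h₁ h₂ h₃
    have h₄ := x.mp _ _ (x.subset (hL.subst
      (fun n => if n = 0 then MFormula.and φ (MFormula.neg (MFormula.imp α β))
        else MFormula.and φ (MFormula.neg α)) _ hL.dia_or)) (mono (by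
          intro v d
          simp only [boolEval, MFormula.neg, MFormula.and, MFormula.or, MFormula.subst, if_true,
            one_ne_zero, if_false]
          tauto) h₃)
    exact h₂ (x.mp _ _ h₄ ((mem_neg x).2 h₁))
  have hbot : MFormula.bot ∉ T := by
    refine fun h' => h' (mono ?_ h)
    intro v d; simp only [boolEval, MFormula.neg, MFormula.and]; tauto
  obtain ⟨y, hTy, -⟩ := exists_world hL hLT hT hbot
  refine ⟨y, fun ψ hψ => ?_, hTy fun h' => (mem_neg x).1 (x.subset hL.dia_bot) (mono ?_ h')⟩
  · by_contra hc
    refine (mem_neg y).1 (hTy (a := MFormula.neg ψ) fun h' => hc (mono ?_ h')) hψ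
    intro v d; simp only [boolEval, MFormula.neg, MFormula.and]; tauto
  · intro v d; simp only [boolEval, MFormula.neg, MFormula.and]; tauto

theorem sat_iff_mem (hL : IsNormalLogic L) : Sat Rel Val φ x ↔ φ ∈ x.carrier := by
  induction φ generalizing x with
  | var n => rfl
  | bot => exact iff_of_false id x.consistent
  | imp φ ψ hφ hψ => rw [mem_imp x hL, Sat, hφ, hψ]
  | dia φ ih =>
    constructor
    · rintro ⟨y, hy, hs⟩
      exact hy φ ((ih y).1 hs)
    · intro h
      obtain ⟨y, hy, hφ⟩ := exists_rel x hL h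
      exact ⟨y, hy, (ih y).2 hφ⟩

variable {x y z}

theorem eq_of_subset (h : y.carrier ⊆ x.carrier) : x = y := by
  refine World.ext (Set.Subset.antisymm (fun φ hφ => ?_) h)
  exact (y.complete φ).resolve_right fun h' => (mem_neg x).1 (h h') hφ

end World

theorem mem_iff_forall_sat (hL : IsNormalLogic L) {φ : MFormula} :
    φ ∈ L ↔ ∀ x : World L, Sat World.Rel World.Val φ x := by
  simp only [World.sat_iff_mem _ hL]
  refine ⟨fun h x => x.subset h, fun h => ?_⟩
  by_contra hφ
  obtain ⟨w, -, hw⟩ := exists_world hL subset_rfl hL.mp hφ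
  exact hw (h w)

/-- One conjunct excludes `y` itself, because distinct worlds differ on a formula; the other
excludes all successors of `y`. -/
theorem World.exists_separating (hL : IsNormalLogic L) (x y : World L)
    (h : ¬ ReflGen World.Rel y x) :
    ∃ φ, Sat World.Rel World.Val φ x ∧
      ∀ z, ReflGen World.Rel y z → ¬ Sat World.Rel World.Val φ z := by
  rw [reflGen_iff, not_or] at h
  obtain ⟨α, hα, hα'⟩ := Set.not_subset.1 fun h' => h.1 (eq_of_subset h').symm
  have h₂ := h.2
  simp only [Rel, not_forall] at h₂
  obtain ⟨β, hβ, hβ'⟩ := h₂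
  rw [← sat_iff_mem _ hL] at hα hα' hβ hβ'
  refine ⟨MFormula.and α β, (sat_and _ _).2 ⟨hα, hβ⟩, fun z hz hs => ?_⟩
  rw [sat_and] at hs
  rcases (reflGen_iff _ _ _).1 hz with rfl | hz
  · exact hα' hs.1
  · exact hβ' ⟨z, hz, hs.2⟩

/-! ### Weakly transitive logics -/

theorem isNormalLogic_generatedBy (Φ : Set MFormula) : IsNormalLogic (generatedBy Φ) where
  taut φ h _ hL _ := hL.taut φ h
  dia_bot _ hL _ := hL.dia_bot
  dia_or _ hL _ := hL.dia_or
  mp φ ψ h₁ h₂ L hL hΦ := hL.mp φ ψ (h₁ L hL hΦ) (h₂ L hL hΦ)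
  subst s φ h L hL hΦ := hL.subst s φ (h L hL hΦ)
  mono φ ψ h L hL hΦ := hL.mono φ ψ (h L hL hΦ)

theorem subset_generatedBy (Φ : Set MFormula) : Φ ⊆ generatedBy Φ := fun _ h _ _ hΦ => hΦ h

theorem generatedBy_subset {Φ : Set MFormula} (hL : IsNormalLogic L) (h : Φ ⊆ L) :
    generatedBy Φ ⊆ L := fun _ hφ => hφ L hL h

theorem wK4_subset_iff (hL : IsNormalLogic L) : wK4 ⊆ L ↔ IsTransitive 1 L := by
  have h : IsTransitive 1 L ↔ MFormula.imp (MFormula.dia (MFormula.dia (MFormula.var 0)))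
      (MFormula.or (MFormula.dia (MFormula.var 0)) (MFormula.var 0)) ∈ L := by
    constructor <;> refine hL.mp _ _ (hL.taut _ ?_) <;>
    · intro v d
      simp only [boolEval, transFormula, diaLE, diaPow, MFormula.or, MFormula.neg]
      tauto
  rw [h]
  exact ⟨fun h' => h' (subset_generatedBy _ rfl), fun h' =>
    generatedBy_subset hL (Set.singleton_subset_iff.2 h')⟩

theorem isNormalLogic_wK4 : IsNormalLogic wK4 := isNormalLogic_generatedBy _

/-- A formula separating `z` from the reflexive cone of `x` would refute an instance of
1-transitivity at `x`. -/
theorem weaklyTransitive_rel (hL : IsNormalLogic L) (hwL : wK4 ⊆ L) :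
    WeaklyTransitive (World.Rel (L := L)) := by
  intro x y z hxy hyz
  by_contra! hc
  obtain ⟨φ, hφ, hn⟩ := World.exists_separating hL z x (by
    rw [reflGen_iff, not_or]
    exact ⟨fun e => hc.2 e.symm, hc.1⟩)
  have h := hL.subst (fun _ => φ) _ ((wK4_subset_iff hL).1 hwL)
  have h := (mem_iff_forall_sat hL).1 h x ⟨y, hxy, z, hyz, hφ⟩
  obtain ⟨w, hw, hs⟩ := (sat_diaLE_one φ).1 (show Sat _ _ (diaLE 1 φ) x from h)
  exact hn w hw hs

theorem iff_trans_mem (hL : IsNormalLogic L) {φ ψ χ : MFormula} (h₁ : MFormula.iff φ ψ ∈ L)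
    (h₂ : MFormula.iff ψ χ ∈ L) : MFormula.iff φ χ ∈ L := by
  rw [mem_iff_forall_sat hL] at *
  intro x
  have := h₁ x
  have := h₂ x
  simp only [sat_iff] at *
  tauto

theorem iff_symm_mem (hL : IsNormalLogic L) {φ ψ : MFormula} (h : MFormula.iff φ ψ ∈ L) :
    MFormula.iff ψ φ ∈ L := by
  rw [mem_iff_forall_sat hL] at *
  intro x
  have := h x
  simp only [sat_iff] at *
  tauto

theorem iff_refl_mem (hL : IsNormalLogic L) (φ : MFormula) : MFormula.iff φ φ ∈ L := by
  rw [mem_iff_forall_sat hL]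
  intro x
  rw [sat_iff]

/-! ### Modal depth and local tabularity -/

theorem modalDepth_le_of_heightLE (hL : IsNormalLogic L) (hwL : wK4 ⊆ L) {h : ℕ}
    (hh : ∀ x : World L, HeightLE World.Rel h x) : modalDepth L ≤ (2 * h : ℕ) := by
  refine iSup_le fun φ => ?_
  obtain ⟨k, hk⟩ := exists_isKFormula φ
  obtain ⟨l, hl, hs⟩ := exists_sublist_sat_iff (R := World.Rel (L := L)) (V := World.Val)
    (k := k) (n := 2 * h) (U := Sat World.Rel World.Val φ) fun x y e hx =>
      ((NEquiv.of_heightLE (weaklyTransitive_rel hL hwL) h (hh x) e φ.depth).sat_iff hk le_rfl).1 hx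
  refine (iInf₂_le (disj l) ?_).trans (Nat.cast_le.2 (depth_disj_le_of_mem_sublists hl))
  rw [mem_iff_forall_sat hL]
  intro x
  rw [sat_iff, hs]

theorem heightLE_of_mem (hL : IsNormalLogic L) {h : ℕ}
    (hh : (heightFormula h).replaceDia 1 ∈ L) (x : World L) : HeightLE World.Rel h x :=
  heightLE_of_sat_subst (World.exists_separating hL) h fun s =>
    (mem_iff_forall_sat hL).1 (hL.subst s _ hh) x

theorem isLocallyTabular_of_modalDepth_lt_top (hL : IsNormalLogic L) (h : modalDepth L < ⊤) :
    IsLocallyTabular L := by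
  obtain ⟨d, hd⟩ := ENat.ne_top_iff_exists.1 h.ne
  intro k
  refine ((List.finite_toSet (atoms (typeFormulas k d)).sublists).image fun l =>
    {ψ : MFormula | ψ.IsKFormula k ∧ MFormula.iff (disj l) ψ ∈ L}).subset ?_
  rintro C ⟨φ, hφ, rfl⟩
  have hlt : formulaDepth L φ < ((d + 1 : ℕ) : ℕ∞) :=
    ((le_iSup (formulaDepth L) φ).trans hd.symm.le).trans_lt (Nat.cast_lt.2 d.lt_succ_self)
  simp only [formulaDepth, iInf_lt_iff, Nat.cast_lt] at hlt
  obtain ⟨ψ, hψ, hlt⟩ := hlt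
  -- The shallow equivalent `ψ` may use variables outside the first `k`; replacing them by `⊥`
  -- leaves `φ` fixed and does not raise the depth.
  have hχ := hL.subst (truncate k) _ hψ
  change MFormula.iff (φ.subst (truncate k)) (ψ.subst (truncate k)) ∈ L at hχ
  rw [hφ.subst_truncate] at hχ
  have hχd := (depth_subst_truncate_le k ψ).trans (Nat.lt_succ_iff.1 hlt)
  have hχk := isKFormula_subst_truncate k ψ
  generalize ψ.subst (truncate k) = χ at hχ hχd hχk
  obtain ⟨l, hl, hs⟩ := exists_sublist_sat_iff (R := World.Rel (L := L)) (V := World.Val)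
    (k := k) (n := d) (U := Sat World.Rel World.Val χ) fun x y e hx => (e.sat_iff hχk hχd).1 hx
  have hχl : MFormula.iff χ (disj l) ∈ L := by
    rw [mem_iff_forall_sat hL]
    intro x
    rw [sat_iff, hs]
  have hφl := iff_trans_mem hL hχ hχl
  refine ⟨l, hl, Set.ext fun θ => and_congr_right fun _ => ⟨?_, ?_⟩⟩
  · exact iff_trans_mem hL hφl
  · exact iff_trans_mem hL (iff_symm_mem hL hφl)

theorem exists_heightFormula_mem_of_isKFinite (hL : IsNormalLogic L) (hwL : wK4 ⊆ L)
    (h : IsKFinite 1 L) : ∃ n, (heightFormula n).replaceDia 1 ∈ L := by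
  by_contra! hc
  let C : ℕ → Set MFormula := fun n =>
    {ψ | ψ.IsKFormula 1 ∧ MFormula.iff (alternation n) ψ ∈ L}
  have key : ∀ {m n}, m < n → MFormula.iff (alternation m) (alternation n) ∉ L := by
    intro m n hmn hmem
    have hx := hc n
    rw [mem_iff_forall_sat hL, not_forall] at hx
    obtain ⟨x, hx⟩ := hx
    obtain ⟨y, hy⟩ := exists_not_sat_alternation_iff (weaklyTransitive_rel hL hwL) hmn hx
    exact hy ((mem_iff_forall_sat hL).1 (hL.subst _ _ hmem) y)
  have hC : ∀ {m n}, C m = C n → MFormula.iff (alternation m) (alternation n) ∈ L := by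
    intro m n hmn
    have : alternation n ∈ C n := ⟨isKFormula_alternation n, iff_refl_mem hL _⟩
    rw [← hmn] at this
    exact this.2
  have hinj : Function.Injective C := by
    intro m n hmn
    rcases lt_trichotomy m n with hlt | heq | hgt
    · exact (key hlt (hC hmn)).elim
    · exact heq
    · exact (key hgt (hC hmn.symm)).elim
  refine Set.infinite_of_injective_forall_mem hinj (fun n => ?_) h
  exact ⟨alternation n, isKFormula_alternation n, rfl⟩

/-! ### The transitivity index -/

theorem isTransitive_zero_of_transIndex (h : transIndex L = 0) : IsTransitive 0 L := by
  have h' : transIndex L < ((1 : ℕ) : ℕ∞) := by simp [h]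
  simp only [transIndex, iInf_lt_iff, Nat.cast_lt] at h'
  obtain ⟨m, hm, hlt⟩ := h'
  obtain rfl : m = 0 := by omega
  exact hm

theorem transIndex_eq_zero_or_one (h : IsTransitive 1 L) :
    transIndex L = (0 : ℕ) ∨ transIndex L = (1 : ℕ) := by
  have h' : transIndex L ≤ (1 : ℕ) := iInf₂_le 1 h
  obtain ⟨m, hm⟩ := ENat.ne_top_iff_exists.1 (h'.trans_lt (ENat.natCast_lt_top 1)).ne
  rw [← hm] at h' ⊢
  rw [Nat.cast_le] at h'
  interval_cases m
  exacts [.inl rfl, .inr rfl]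

/-- The formulas that are valid in the frame of two points with the universal relation. -/
def universalPairLogic : Set MFormula := {φ | ∀ V x, Sat (fun _ _ : Bool => True) V φ x}

theorem sat_of_isTautology {W : Type} {R : W → W → Prop} {V : ℕ → W → Prop} {x : W}
    {φ : MFormula} (h : φ.IsTautology) : Sat R V φ x := by
  have key : ∀ ψ : MFormula, Sat R V ψ x ↔
      ψ.boolEval (fun n => V n x) (fun χ => Sat R V (MFormula.dia χ) x) := by
    intro ψ
    induction ψ with
    | var n => rfl
    | bot => rfl
    | imp ψ χ hψ hχ => rw [Sat, boolEval, hψ, hχ]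
    | dia ψ _ => rfl
  exact (key φ).2 (h _ _)

theorem isNormalLogic_universalPairLogic : IsNormalLogic universalPairLogic where
  taut φ h V x := sat_of_isTautology h
  dia_bot V x := by rintro ⟨y, -, h⟩; exact h
  dia_or V x := by
    rintro ⟨y, hy, h⟩
    rw [sat_or] at h ⊢
    exact h.imp (fun h => ⟨y, hy, h⟩) fun h => ⟨y, hy, h⟩
  mp φ ψ h₁ h₂ V x := h₁ V x (h₂ V x)
  subst s φ h V x := (sat_subst s φ).2 (h _ x)
  mono φ ψ h V x := by
    rintro ⟨y, hy, h'⟩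
    exact ⟨y, hy, h V y h'⟩

/-- Two points that see each other refute `◇p → p`, so index `0` is excluded and the height formulas
of `wK4` use `◇^{≤1}`. -/
theorem transIndex_wK4 : transIndex wK4 = (1 : ℕ) := by
  refine (transIndex_eq_zero_or_one ((wK4_subset_iff isNormalLogic_wK4).1 subset_rfl)).resolve_left
    fun h => ?_
  have hsub : wK4 ⊆ universalPairLogic := by
    refine generatedBy_subset isNormalLogic_universalPairLogic (Set.singleton_subset_iff.2 ?_)
    rintro V x ⟨y, hy, z, hz, h⟩
    exact (sat_or _ _).2 (.inl ⟨z, trivial, h⟩)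
  exact absurd (hsub (isTransitive_zero_of_transIndex h) (fun _ x => x = true) false
    ⟨true, trivial, rfl⟩) Bool.false_ne_true

/-- With `◇φ → φ` in the logic, a successor is a subset of its predecessor, and maximal theories
that are nested coincide. -/
theorem heightLE_one_of_isTransitive_zero (hL : IsNormalLogic L) (h : IsTransitive 0 L)
    (x : World L) : HeightLE World.Rel 1 x := by
  intro y hxy hyx
  rcases (reflGen_iff _ _ _).1 hxy with rfl | hxy
  · exact hyx hxy
  · have : x = y := World.eq_of_subset fun φ hφ =>
      x.mp _ _ (x.subset (hL.subst (fun _ => φ) _ h)) (hxy φ hφ)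
    subst this
    exact hyx .refl

theorem modalDepth_lt_top_of_height_lt_top (hL : IsNormalLogic L) (hwL : wK4 ⊆ L)
    (h : height L < ⊤) : modalDepth L < ⊤ := by
  simp only [height, iInf_lt_iff] at h
  obtain ⟨h, ⟨φ, hφ, m, hm, rfl⟩, -⟩ := h
  rcases transIndex_eq_zero_or_one ((wK4_subset_iff hL).1 hwL) with h₀ | h₁
  · exact (modalDepth_le_of_heightLE hL hwL (heightLE_one_of_isTransitive_zero hL
      (isTransitive_zero_of_transIndex h₀))).trans_lt (ENat.natCast_lt_top _)
  · obtain rfl : m = 1 := Nat.cast_injective (hm.symm.trans h₁)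
    exact (modalDepth_le_of_heightLE hL hwL (heightLE_of_mem hL hφ)).trans_lt (ENat.natCast_lt_top _)

theorem height_lt_top_of_isLocallyTabular (hL : IsNormalLogic L) (hwL : wK4 ⊆ L)
    (h : IsLocallyTabular L) : height L < ⊤ := by
  suffices ∃ n φ, φ ∈ L ∧ IsHeightFormula L n φ by
    obtain ⟨n, φ, hφ, hn⟩ := this
    exact (iInf₂_le n ⟨φ, hφ, hn⟩).trans_lt (ENat.natCast_lt_top n)
  rcases transIndex_eq_zero_or_one ((wK4_subset_iff hL).1 hwL) with h₀ | h₁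
  -- At index `0` the modalities of `B_1^*` disappear and it becomes a tautology.
  · refine ⟨1, _, hL.taut _ ?_, 0, h₀, rfl⟩
    intro v d
    simp only [heightFormula, replaceDia, box, MFormula.or, MFormula.neg, diaLE, boolEval]
    tauto
  · obtain ⟨n, hn⟩ := exists_heightFormula_mem_of_isKFinite hL hwL (h 1)
    exact ⟨n, _, hn, 1, h₁, rfl⟩

theorem modalDepth_withHeight_wK4_le (h : ℕ) :
    modalDepth (withHeight wK4 h) ≤ (2 * h : ℕ) := by
  have hL : IsNormalLogic (withHeight wK4 h) := isNormalLogic_generatedBy _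
  refine modalDepth_le_of_heightLE hL (Set.subset_union_left.trans (subset_generatedBy _))
    (heightLE_of_mem hL (subset_generatedBy _ (.inr ⟨1, transIndex_wK4, rfl⟩)))

theorem isLocallyTabular_tfae (hL : IsNormalLogic L) (hwL : wK4 ⊆ L) :
    [IsLocallyTabular L, modalDepth L < ⊤, height L < ⊤].TFAE := by
  tfae_have 1 → 3 := height_lt_top_of_isLocallyTabular hL hwL
  tfae_have 3 → 2 := modalDepth_lt_top_of_height_lt_top hL hwL
  tfae_have 2 → 1 := isLocallyTabular_of_modalDepth_lt_top hL
  tfae_finish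

end NormalLogic

theorem mainTheorem8 :
    IsLeast {L : Set MFormula | IsNormalLogic L ∧ NormalLogic.IsTransitive 1 L} NormalLogic.wK4 ∧
    (∀ h : ℕ, 0 < h →
      NormalLogic.modalDepth (NormalLogic.withHeight NormalLogic.wK4 h) ≤ ((4 * h - 2 : ℕ) : ℕ∞)) ∧
    (∀ L : Set MFormula, IsNormalLogic L → NormalLogic.wK4 ⊆ L →
      [NormalLogic.IsLocallyTabular L, NormalLogic.modalDepth L < ⊤,
        NormalLogic.height L < ⊤].TFAE) ∧
    (∀ L : Set MFormula, IsNormalLogic L → NormalLogic.IsTransitive 1 L →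
      NormalLogic.IsLocallyTabular L → NormalLogic.modalDepth L < ⊤) := by
  refine ⟨⟨⟨NormalLogic.isNormalLogic_wK4, ?_⟩, fun L hL => ?_⟩, fun h hh => ?_,
    fun L hL hwL => NormalLogic.isLocallyTabular_tfae hL hwL, fun L hL ht => ?_⟩
  · exact (NormalLogic.wK4_subset_iff NormalLogic.isNormalLogic_wK4).1 subset_rfl
  · exact (NormalLogic.wK4_subset_iff hL.1).2 hL.2
  -- The proved bound `2h` is stronger; positivity of `h` gives `2h ≤ 4h - 2`.
  · exact (NormalLogic.modalDepth_withHeight_wK4_le h).trans (Nat.cast_le.2 (by omega))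
  · exact ((NormalLogic.isLocallyTabular_tfae hL
      ((NormalLogic.wK4_subset_iff hL).2 ht)).out 0 1).1
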